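/- For a positive integer $N$ let $p = N^{-3/4}$, let $S$ be a random graph drawn from $G(N,p)$ (the vertex set has $N$ labelled vertices, and each of the $\binom N2$ possible edges is present independently with probability $p$), let $f_{K_3}(S)$ be the number of triangles of $S$, and let $\mathbb E_N f_{K_3}$ be the expected value of $f_{K_3}(S)$. Then there is a function $t:\mathbb N\to\mathbb R$ with $t(N) = o(\mathbb E_N f_{K_3})$ as $N\to\infty$ such that, for all sufficiently large $N$, $$\Pr_{S\sim G(N,p)}\Big[\,\big|f_{K_3}(S) - \mathbb E_N f_{K_3}\big| \ge t(N)\,\Big] < \exp\!\big(-N^{1/13}\big).$$ -/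

import Mathlib

open MeasureTheory Filter Asymptotics

/-- The edge probability `p = N ^ (-3/4)`. -/
noncomputable def edgeProb (N : ℕ) : unitInterval :=
  ⟨(N : ℝ) ^ (-(3 / 4) : ℝ), by positivity, by
    rcases Nat.eq_zero_or_pos N with rfl | h
    · rw [Nat.cast_zero, Real.zero_rpow (by norm_num)]
      exact zero_le_one
    · exact Real.rpow_le_one_of_one_le_of_nonpos (by exact_mod_cast h) (by norm_num)⟩

/-- The law of the random graph `G(N, p)` on `N` labelled vertices with `p = N ^ (-3/4)`: each of
the `N.choose 2` possible edges is drawn independently with probability `p`. -/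
noncomputable def randomGraph (N : ℕ) : Measure (SimpleGraph (Fin N)) :=
  SimpleGraph.binomialRandom (Fin N) (edgeProb N)

/-- The number of triangles (sets of three pairwise adjacent vertices) of a graph. -/
noncomputable def triangleCount {N : ℕ} (G : SimpleGraph (Fin N)) : ℝ :=
  ((G.cliqueSet 3).ncard : ℝ)

/-- The expected number of triangles in `G(N, N ^ (-3/4))`. -/
noncomputable def expectedTriangles (N : ℕ) : ℝ :=
  ∫ G, triangleCount G ∂(randomGraph N)

/-! Seen as triples of edges, the triangles form a linear hypergraph: at most `N` of them contain a
given edge, at most one contains two given edges. Everything is proved for such triple systems in a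
`p`-random set. Put `x = N^(1/8)`, so `p = x^(-6)`, the mean is `μ ≥ x^6 / 12`, and `N p^2 ≤ 1`; the
deviation allowed is `t = μ / x`.

Upper tail: in the `k`-th moment of the count, forcing a set of at most `3k` edges to be present
raises the conditional mean to at most `μ + 3k·N p^2 + (3k)^2` (`sum_le`, `bernoulliExp_pow_le`).
For `k ≈ x^2` the excess is `O(x^4)`, below `μ / (2x)`, and Markov's inequality gives `exp(-x/4)`.

Lower tail: Janson's argument. Harris' inequality yields a differential inequality for the Laplace
transform (`bernoulliExp_mul_exp_ge`, `laplace_le`), and Markov's inequality again gives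
`exp(-x/4)`. Since `1/13 < 1/8`, the sum of the two tails is eventually below `exp(-N^(1/13))`. -/

/-! ### Expectations over a `p`-random subset, and Harris' inequality. -/

section BernoulliExpectation

variable {α ι : Type*} [Fintype α]

/-- The probability that a `p`-random subset of `α` equals `S`. -/
noncomputable def bernoulliWeight (p : ℝ) (S : Finset α) : ℝ :=
  p ^ S.card * (1 - p) ^ (Fintype.card α - S.card)

/-- The expectation of `F` at a `p`-random subset of `α`. -/
noncomputable def bernoulliExp (p : ℝ) (F : Finset α → ℝ) : ℝ :=
  ∑ S, bernoulliWeight p S * F S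

lemma bernoulliWeight_nonneg {p : ℝ} (h0 : 0 ≤ p) (h1 : p ≤ 1) (S : Finset α) :
    0 ≤ bernoulliWeight p S :=
  mul_nonneg (pow_nonneg h0 _) (pow_nonneg (sub_nonneg.2 h1) _)

lemma sum_bernoulliWeight (p : ℝ) : ∑ S : Finset α, bernoulliWeight p S = 1 := by
  have := Fintype.sum_pow_mul_eq_add_pow α p (1 - p)
  simpa [bernoulliWeight] using this

lemma bernoulliExp_mono {p : ℝ} (h0 : 0 ≤ p) (h1 : p ≤ 1) {F G : Finset α → ℝ}
    (h : ∀ S, F S ≤ G S) : bernoulliExp p F ≤ bernoulliExp p G :=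
  Finset.sum_le_sum fun S _ => mul_le_mul_of_nonneg_left (h S) (bernoulliWeight_nonneg h0 h1 S)

lemma bernoulliExp_const (p c : ℝ) : bernoulliExp p (fun _ : Finset α => c) = c := by
  rw [bernoulliExp, ← Finset.sum_mul, sum_bernoulliWeight, one_mul]

lemma bernoulliExp_sum (p : ℝ) (I : Finset ι) (F : ι → Finset α → ℝ) :
    bernoulliExp p (fun S => ∑ i ∈ I, F i S) = ∑ i ∈ I, bernoulliExp p (F i) := by
  simp only [bernoulliExp, Finset.mul_sum]
  exact Finset.sum_comm

lemma bernoulliExp_const_mul (p c : ℝ) (F : Finset α → ℝ) :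
    bernoulliExp p (fun S => c * F S) = c * bernoulliExp p F := by
  simp only [bernoulliExp, Finset.mul_sum]
  exact Finset.sum_congr rfl fun S _ => by ring

lemma bernoulliExp_sub (p : ℝ) (F G : Finset α → ℝ) :
    bernoulliExp p (fun S => F S - G S) = bernoulliExp p F - bernoulliExp p G := by
  simp only [bernoulliExp, mul_sub, Finset.sum_sub_distrib]

variable [DecidableEq α]

/-- Pairing each `S` avoiding `a` with `insert a S` separates the coin of `a` from the others. -/
lemma bernoulliExp_mem_mul (p : ℝ) (a : α) (F : Finset α → ℝ) :
    bernoulliExp p (fun S => if a ∈ S then F S else 0) =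
      p * bernoulliExp p (fun S => F (insert a S)) := by
  have split : ∀ f : Finset α → ℝ, ∑ S, f S =
      ∑ S ∈ (Finset.univ.erase a).powerset, (f S + f (insert a S)) := by
    intro f
    rw [Finset.sum_add_distrib, ← Finset.sum_powerset_insert (Finset.notMem_erase a _),
      Finset.insert_erase (Finset.mem_univ a), Finset.powerset_univ]
  simp only [bernoulliExp]
  rw [split, split, Finset.mul_sum]
  refine Finset.sum_congr rfl fun S hS => ?_
  have ha : a ∉ S := fun h => Finset.notMem_erase a _ (Finset.mem_powerset.1 hS h)
  have hc : S.card + 1 ≤ Fintype.card α := by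
    rw [← Finset.card_insert_of_notMem ha]; exact Finset.card_le_univ _
  obtain ⟨d, hd⟩ := Nat.exists_eq_add_of_le hc
  have h1 : Fintype.card α - S.card = d + 1 := by omega
  have h2 : Fintype.card α - (S.card + 1) = d := by omega
  simp only [bernoulliWeight, ha, if_false, Finset.mem_insert_self, if_true, Finset.insert_idem,
    Finset.card_insert_of_notMem ha, h1, h2]
  ring

/-- Conditioning on `A ⊆ S` leaves the points outside `A` independent, so it amounts to replacing
`S` by `S ∪ A`. -/
lemma bernoulliExp_subset_mul (p : ℝ) (A : Finset α) (F : Finset α → ℝ) :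
    bernoulliExp p (fun S => if A ⊆ S then F S else 0) =
      p ^ A.card * bernoulliExp p (fun S => F (S ∪ A)) := by
  induction A using Finset.induction_on generalizing F with
  | empty => simp
  | insert a A ha ih =>
    have h1 : (fun S => if insert a A ⊆ S then F S else 0) =
        fun S => if a ∈ S then (if A ⊆ S then F S else 0) else 0 := by
      funext S
      by_cases h : a ∈ S <;> simp [Finset.insert_subset_iff, h]
    have h2 : (fun S => if A ⊆ insert a S then F (insert a S) else 0) =
        fun S => if A ⊆ S then F (insert a S) else 0 := by
      funext S
      simp only [Finset.subset_insert_iff_of_notMem ha]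
    rw [h1, bernoulliExp_mem_mul, h2, ih, Finset.card_insert_of_notMem ha, pow_succ]
    simp only [Finset.union_insert]
    ring

/-- The lattice condition of the FKG inequality; for a product measure it is an equality. -/
lemma bernoulliWeight_mul_le (p : ℝ) (S S' : Finset α) :
    bernoulliWeight p S * bernoulliWeight p S' ≤
      bernoulliWeight p (S ⊓ S') * bernoulliWeight p (S ⊔ S') := by
  apply le_of_eq
  have h := Finset.card_union_add_card_inter S S'
  have h1 := Finset.card_le_univ (S ∪ S')
  have h2 := Finset.card_le_card (Finset.subset_union_left (s₁ := S) (s₂ := S'))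
  have h3 := Finset.card_le_card (Finset.subset_union_right (s₁ := S) (s₂ := S'))
  simp only [bernoulliWeight, Finset.inf_eq_inter, Finset.sup_eq_union]
  rw [mul_mul_mul_comm, mul_mul_mul_comm (p ^ (S ∩ S').card), ← pow_add, ← pow_add, ← pow_add,
    ← pow_add]
  congr 2 <;> omega

/-- Harris' inequality for decreasing functions with values in `[0, 1]`. -/
lemma bernoulliExp_mul_le_of_antitone {p : ℝ} (h0 : 0 ≤ p) (h1 : p ≤ 1) {F G : Finset α → ℝ}
    (hF : Antitone F) (hG : Antitone G) (hF1 : ∀ S, F S ≤ 1) (hG1 : ∀ S, G S ≤ 1) :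
    bernoulliExp p F * bernoulliExp p G ≤ bernoulliExp p (fun S => F S * G S) := by
  -- `fkg` needs nonnegative increasing functions, hence the complements `1 - F` and `1 - G`.
  have key := fkg (μ := bernoulliWeight (α := α) p) (f := fun S => 1 - F S)
    (g := fun S => 1 - G S) (bernoulliWeight_nonneg h0 h1) (fun S => sub_nonneg.2 (hF1 S))
    (fun S => sub_nonneg.2 (hG1 S)) (fun S S' h => sub_le_sub_left (hF h) _)
    (fun S S' h => sub_le_sub_left (hG h) _) (bernoulliWeight_mul_le p)
  rw [sum_bernoulliWeight, one_mul] at key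
  change bernoulliExp p _ * bernoulliExp p _ ≤ bernoulliExp p _ at key
  have e : (fun S => (1 - F S) * (1 - G S)) =
      fun S => ((1 : ℝ) - F S) - (G S - F S * G S) := by funext S; ring
  rw [e] at key
  simp only [bernoulliExp_sub, bernoulliExp_const] at key
  linarith

end BernoulliExpectation

/-! ### Tail bounds for linear triple systems. -/

section LinearHypergraph

variable {α ι : Type*} [DecidableEq α]

/-- The indexed family `T i`, `i ∈ I`, consists of three-element sets, at most `D` of which contain
a given point and at most one of which contains two given points. -/
structure IsLinearTripleSystem (I : Finset ι) (T : ι → Finset α) (D : ℕ) : Prop where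
  card_eq : ∀ i ∈ I, (T i).card = 3
  degree_le : ∀ a, (I.filter fun i => a ∈ T i).card ≤ D
  codegree_le : ∀ a b, a ≠ b → (I.filter fun i => a ∈ T i ∧ b ∈ T i).card ≤ 1

/-- The number of members of the family `T i`, `i ∈ I`, contained in `S`. -/
noncomputable def containedCount (I : Finset ι) (T : ι → Finset α) (S : Finset α) : ℝ :=
  ∑ i ∈ I, if T i ⊆ S then 1 else 0

lemma containedCount_nonneg (I : Finset ι) (T : ι → Finset α) (S : Finset α) :
    0 ≤ containedCount I T S :=
  Finset.sum_nonneg fun _ _ => by split_ifs <;> norm_num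

lemma containedCount_mul (I : Finset ι) (T : ι → Finset α) (S : Finset α) (c : ℝ) :
    containedCount I T S * c = ∑ i ∈ I, if T i ⊆ S then c else 0 := by
  simp only [containedCount, Finset.sum_mul, ite_mul, one_mul, zero_mul]

lemma containedCount_mono (I : Finset ι) (T : ι → Finset α) : Monotone (containedCount I T) := by
  intro S S' h
  refine Finset.sum_le_sum fun i _ => ?_
  by_cases h1 : T i ⊆ S
  · simp [h1, h1.trans h]
  · rw [if_neg h1]; split_ifs <;> norm_num

variable {I : Finset ι} {T : ι → Finset α} {D : ℕ}

/-- A triple meeting `A` in one point has weight `p^2`, and there are at most `D` for each point. A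
triple meeting `A` in more contains a pair from `A`; by linearity there are at most `|A|^2` of
these, each of weight at most 1. -/
lemma IsLinearTripleSystem.sum_meeting_le (h : IsLinearTripleSystem I T D) {p : ℝ} (h0 : 0 ≤ p)
    (h1 : p ≤ 1) (A : Finset α) :
    ∑ i ∈ I, (if Disjoint (T i) A then 0 else p ^ (T i \ A).card) ≤
      A.card * (D * p ^ 2) + (A.card : ℝ) ^ 2 := by
  have term : ∀ i ∈ I, (if Disjoint (T i) A then 0 else p ^ (T i \ A).card) ≤
      (∑ a ∈ A, if a ∈ T i then p ^ 2 else 0) +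
        ∑ e ∈ A.offDiag, if e.1 ∈ T i ∧ e.2 ∈ T i then (1 : ℝ) else 0 := by
    intro i hi
    have hp2 : 0 ≤ p ^ 2 := sq_nonneg p
    have n1 : ∀ a ∈ A, (0 : ℝ) ≤ if a ∈ T i then p ^ 2 else 0 := fun a _ => by
      split_ifs <;> simp [hp2]
    have n2 : ∀ e ∈ A.offDiag, (0 : ℝ) ≤ if e.1 ∈ T i ∧ e.2 ∈ T i then (1 : ℝ) else 0 :=
      fun a _ => by split_ifs <;> simp
    by_cases hd : Disjoint (T i) A
    · rw [if_pos hd]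
      exact add_nonneg (Finset.sum_nonneg n1) (Finset.sum_nonneg n2)
    · rw [if_neg hd]
      obtain ⟨a, haT, haA⟩ := Finset.not_disjoint_iff.1 hd
      by_cases hb : ∃ b ∈ T i ∩ A, b ≠ a
      · obtain ⟨b, hb, hba⟩ := hb
        rw [Finset.mem_inter] at hb
        have := Finset.single_le_sum n2 (a := (a, b))
          (by simp only [Finset.mem_offDiag]; exact ⟨haA, hb.2, hba.symm⟩)
        simp only [haT, hb.1, and_self, if_true] at this
        have := pow_le_one₀ h0 h1 (n := (T i \ A).card)
        linarith [Finset.sum_nonneg n1]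
      · push Not at hb
        have hs : T i ∩ A = {a} := by
          ext b
          simp only [Finset.mem_singleton]
          exact ⟨hb b, fun hba => by rw [hba]; exact Finset.mem_inter.2 ⟨haT, haA⟩⟩
        have hc : (T i \ A).card = 2 := by
          have := Finset.card_sdiff_add_card_inter (T i) A
          rw [hs, h.card_eq i hi, Finset.card_singleton] at this
          omega
        have := Finset.single_le_sum n1 haA
        rw [if_pos haT] at this
        rw [hc]
        linarith [Finset.sum_nonneg n2]
  refine (Finset.sum_le_sum term).trans ?_
  rw [Finset.sum_add_distrib, Finset.sum_comm, Finset.sum_comm (s := I) (t := A.offDiag)]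
  refine add_le_add ?_ ?_
  · rw [← nsmul_eq_mul]
    refine Finset.sum_le_card_nsmul _ _ _ fun a _ => ?_
    rw [← Finset.sum_filter, Finset.sum_const, nsmul_eq_mul]
    exact mul_le_mul_of_nonneg_right (by exact_mod_cast h.degree_le a) (sq_nonneg p)
  · have : (A.offDiag.card : ℝ) ≤ (A.card : ℝ) ^ 2 := by
      rw [Finset.offDiag_card, sq]
      exact_mod_cast Nat.sub_le _ _
    refine le_trans ?_ this
    rw [← mul_one (A.offDiag.card : ℝ), ← nsmul_eq_mul]
    refine Finset.sum_le_card_nsmul _ _ _ fun e he => ?_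
    rw [← Finset.sum_filter, Finset.sum_const, nsmul_eq_mul, mul_one]
    exact_mod_cast h.codegree_le _ _ (Finset.mem_offDiag.1 he).2.2

lemma IsLinearTripleSystem.sum_le (h : IsLinearTripleSystem I T D) {p : ℝ} (h0 : 0 ≤ p)
    (h1 : p ≤ 1) (A : Finset α) :
    ∑ i ∈ I, p ^ (T i \ A).card ≤
      I.card * p ^ 3 + (A.card * (D * p ^ 2) + (A.card : ℝ) ^ 2) := by
  have term : ∀ i ∈ I, p ^ (T i \ A).card ≤
      p ^ 3 + if Disjoint (T i) A then 0 else p ^ (T i \ A).card := by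
    intro i hi
    by_cases hd : Disjoint (T i) A
    · rw [if_pos hd, Finset.sdiff_eq_self_of_disjoint hd, h.card_eq i hi, add_zero]
    · rw [if_neg hd]
      linarith [pow_nonneg h0 3]
  refine (Finset.sum_le_sum term).trans ?_
  rw [Finset.sum_add_distrib, Finset.sum_const, nsmul_eq_mul]
  linarith [h.sum_meeting_le h0 h1 A]

variable [Fintype α]

lemma IsLinearTripleSystem.bernoulliExp_containedCount (h : IsLinearTripleSystem I T D) (p : ℝ) :
    bernoulliExp p (containedCount I T) = I.card * p ^ 3 := by
  change bernoulliExp p (fun S => ∑ i ∈ I, if T i ⊆ S then (1 : ℝ) else 0) = _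
  rw [bernoulliExp_sum, ← nsmul_eq_mul, ← Finset.sum_const]
  refine Finset.sum_congr rfl fun i hi => ?_
  rw [bernoulliExp_subset_mul p (T i) fun _ => 1, bernoulliExp_const, h.card_eq i hi, mul_one]

/-- Peel off one factor of the power as a sum over `i` and absorb `T i` into `A`, which grows by at
most 3. The uniform bound `m` on all the sets met makes every step cost the same factor. -/
lemma IsLinearTripleSystem.bernoulliExp_pow_le (h : IsLinearTripleSystem I T D) {p : ℝ}
    (h0 : 0 ≤ p) (h1 : p ≤ 1) {m k : ℕ} {A : Finset α} (hA : A.card + 3 * k ≤ m) :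
    bernoulliExp p (fun S => if A ⊆ S then containedCount I T S ^ k else 0) ≤
      p ^ A.card * (I.card * p ^ 3 + (m * (D * p ^ 2) + (m : ℝ) ^ 2)) ^ k := by
  have hB : 0 ≤ I.card * p ^ 3 + (m * (D * p ^ 2) + (m : ℝ) ^ 2) := by positivity
  induction k generalizing A with
  | zero =>
    simp only [pow_zero, mul_one]
    rw [bernoulliExp_subset_mul p A fun _ => 1, bernoulliExp_const, mul_one]
  | succ k ih =>
    have e : (fun S => if A ⊆ S then containedCount I T S ^ (k + 1) else 0) =
        fun S => ∑ i ∈ I, if A ∪ T i ⊆ S then containedCount I T S ^ k else 0 := by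
      funext S
      by_cases hS : A ⊆ S
      · simp only [Finset.union_subset_iff, hS, true_and, if_true]
        rw [pow_succ', containedCount_mul]
      · simp [Finset.union_subset_iff, hS]
    rw [e, bernoulliExp_sum]
    have hcard : ∀ i ∈ I, (A ∪ T i).card + 3 * k ≤ m := by
      intro i hi
      have := Finset.card_union_le A (T i)
      rw [h.card_eq i hi] at this
      omega
    refine (Finset.sum_le_sum fun i hi => ih (hcard i hi)).trans ?_
    rw [← Finset.sum_mul, pow_succ' (_ + _), ← mul_assoc (p ^ A.card)]
    refine mul_le_mul_of_nonneg_right ?_ (pow_nonneg hB k)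
    have e2 : ∀ i, p ^ (A ∪ T i).card = p ^ A.card * p ^ (T i \ A).card := by
      intro i
      rw [← pow_add, add_comm, Finset.card_sdiff_add_card, Finset.union_comm]
    simp only [e2]
    rw [← Finset.mul_sum]
    refine mul_le_mul_of_nonneg_left ((h.sum_le h0 h1 A).trans ?_) (pow_nonneg h0 _)
    have : (A.card : ℝ) ≤ m := by exact_mod_cast (by omega : A.card ≤ m)
    gcongr

/-- Upper tail estimate from the `k`-th moment. -/
lemma IsLinearTripleSystem.upper_tail (h : IsLinearTripleSystem I T D) {p : ℝ}
    (h0 : 0 ≤ p) (h1 : p ≤ 1) (k : ℕ) {y : ℝ} (hy : 0 < y) :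
    bernoulliExp p (fun S => if y ≤ containedCount I T S then 1 else 0) ≤
      ((I.card * p ^ 3 + ((3 * k : ℕ) * (D * p ^ 2) + ((3 * k : ℕ) : ℝ) ^ 2)) / y) ^ k := by
  have key := h.bernoulliExp_pow_le h0 h1 (m := 3 * k) (k := k) (A := ∅) (by simp)
  simp only [Finset.empty_subset, if_true, Finset.card_empty, pow_zero, one_mul] at key
  rw [div_pow, le_div_iff₀ (pow_pos hy k), mul_comm, ← bernoulliExp_const_mul]
  refine (bernoulliExp_mono h0 h1 fun S => ?_).trans key
  by_cases hS : y ≤ containedCount I T S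
  · rw [if_pos hS, mul_one]
    exact pow_le_pow_left₀ hy.le hS k
  · rw [if_neg hS, mul_zero]
    exact pow_nonneg (containedCount_nonneg I T S) k

/-- Forcing `T i ⊆ S` raises the count by at most `Z`, the number of triples meeting `T i` whose
remainder lies in `S`. Harris' inequality decouples `exp(-sX)` from `exp(-sZ)`, and the latter has
mean at least `1 - s E Z`. -/
lemma IsLinearTripleSystem.bernoulliExp_mul_exp_ge (h : IsLinearTripleSystem I T D) {p : ℝ}
    (h0 : 0 ≤ p) (h1 : p ≤ 1) {s : ℝ} (hs : 0 ≤ s) {i : ι} (hi : i ∈ I) :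
    p ^ 3 * (bernoulliExp p (fun S => Real.exp (-(s * containedCount I T S))) *
        (1 - s * (3 * (D * p ^ 2) + 9))) ≤
      bernoulliExp p
        (fun S => if T i ⊆ S then Real.exp (-(s * containedCount I T S)) else 0) := by
  set X := containedCount I T with hX
  rw [bernoulliExp_subset_mul p (T i) fun S => Real.exp (-(s * X S)), h.card_eq i hi]
  refine mul_le_mul_of_nonneg_left ?_ (pow_nonneg h0 3)
  let Z : Finset α → ℝ := fun S =>
    ∑ j ∈ I, if Disjoint (T j) (T i) then 0 else if T j \ T i ⊆ S then 1 else 0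
  have hZ0 : ∀ S, 0 ≤ Z S := fun S => Finset.sum_nonneg fun j _ => by split_ifs <;> norm_num
  have hZmono : Monotone Z := by
    intro S S' hSS
    refine Finset.sum_le_sum fun j _ => ?_
    by_cases hd : Disjoint (T j) (T i)
    · simp [hd]
    · by_cases hS : T j \ T i ⊆ S
      · simp [hd, hS, hS.trans hSS]
      · rw [if_neg hd, if_neg hS]; split_ifs <;> norm_num
  have hXZ : ∀ S, X (S ∪ T i) ≤ X S + Z S := by
    intro S
    simp only [hX, containedCount, Z]
    rw [← Finset.sum_add_distrib]
    refine Finset.sum_le_sum fun j _ => ?_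
    by_cases hS : T j ⊆ S ∪ T i
    · rw [if_pos hS]
      by_cases hd : Disjoint (T j) (T i)
      · have : T j ⊆ S := Disjoint.left_le_of_le_sup_right hS hd
        simp [hd, this]
      · have : T j \ T i ⊆ S := by
          intro a ha
          rw [Finset.mem_sdiff] at ha
          exact (Finset.mem_union.1 (hS ha.1)).resolve_right ha.2
        rw [if_neg hd, if_pos this]
        split_ifs <;> norm_num
    · rw [if_neg hS]
      split_ifs <;> norm_num
  have hEZ : bernoulliExp p Z ≤ 3 * (D * p ^ 2) + 9 := by
    have := h.sum_meeting_le h0 h1 (T i)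
    rw [h.card_eq i hi] at this
    norm_num at this
    refine le_trans (le_of_eq ?_) this
    rw [bernoulliExp_sum]
    refine Finset.sum_congr rfl fun j _ => ?_
    by_cases hd : Disjoint (T j) (T i)
    · simp only [hd, if_true]
      exact bernoulliExp_const p 0
    · simp only [hd, if_false]
      rw [bernoulliExp_subset_mul p (T j \ T i) fun _ => 1, bernoulliExp_const, mul_one]
  have anti : ∀ {W : Finset α → ℝ}, Monotone W → Antitone fun S => Real.exp (-(s * W S)) :=
    fun hW S S' hSS => Real.exp_le_exp.2 (neg_le_neg (mul_le_mul_of_nonneg_left (hW hSS) hs))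
  have le_one : ∀ {W : Finset α → ℝ}, (∀ S, 0 ≤ W S) → ∀ S, Real.exp (-(s * W S)) ≤ 1 :=
    fun hW S => Real.exp_le_one_iff.2 (neg_nonpos.2 (mul_nonneg hs (hW S)))
  have harris := bernoulliExp_mul_le_of_antitone h0 h1 (anti (containedCount_mono I T))
    (anti hZmono) (le_one (containedCount_nonneg I T)) (le_one hZ0)
  have hφ : 0 ≤ bernoulliExp p (fun S => Real.exp (-(s * X S))) := by
    rw [← bernoulliExp_const (α := α) p 0]
    exact bernoulliExp_mono h0 h1 fun S => (Real.exp_pos _).le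
  have hlin : 1 - s * (3 * (D * p ^ 2) + 9) ≤ bernoulliExp p (fun S => Real.exp (-(s * Z S))) := by
    have : bernoulliExp p (fun S => 1 - s * Z S) ≤
        bernoulliExp p (fun S => Real.exp (-(s * Z S))) :=
      bernoulliExp_mono h0 h1 fun S => by linarith [Real.add_one_le_exp (-(s * Z S))]
    rw [bernoulliExp_sub, bernoulliExp_const, bernoulliExp_const_mul] at this
    nlinarith [mul_le_mul_of_nonneg_left hEZ hs]
  refine (mul_le_mul_of_nonneg_left hlin hφ).trans (harris.trans ?_)
  refine bernoulliExp_mono h0 h1 fun S => ?_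
  rw [← Real.exp_add]
  exact Real.exp_le_exp.2 (by nlinarith [mul_le_mul_of_nonneg_left (hXZ S) hs])

omit [DecidableEq α] in
lemma hasDerivAt_bernoulliExp_exp (p s : ℝ) (X : Finset α → ℝ) :
    HasDerivAt (fun s => bernoulliExp p (fun S => Real.exp (-(s * X S))))
      (-bernoulliExp p (fun S => X S * Real.exp (-(s * X S)))) s := by
  simp only [bernoulliExp, ← Finset.sum_neg_distrib]
  refine HasDerivAt.fun_sum fun S _ => ?_
  have := ((((hasDerivAt_id s).mul_const (X S)).neg).exp).const_mul (bernoulliWeight p S)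
  refine this.congr_deriv ?_
  simp only [Pi.neg_apply, id]
  ring

/-- Janson's bound for the Laplace transform. -/
lemma IsLinearTripleSystem.laplace_le (h : IsLinearTripleSystem I T D) {p : ℝ}
    (h0 : 0 ≤ p) (h1 : p ≤ 1) {s : ℝ} (hs : 0 ≤ s) :
    bernoulliExp p (fun S => Real.exp (-(s * containedCount I T S))) ≤
      Real.exp (-(I.card * p ^ 3 * (s - (3 * (D * p ^ 2) + 9) * s ^ 2))) := by
  set X := containedCount I T with hX
  set K : ℝ := 3 * (D * p ^ 2) + 9 with hK
  set μ : ℝ := I.card * p ^ 3 with hμ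
  have hK0 : 0 ≤ K := by positivity
  have hμ0 : 0 ≤ μ := by positivity
  let φ : ℝ → ℝ := fun s => bernoulliExp p (fun S => Real.exp (-(s * X S)))
  have hφ0 : ∀ s, 0 ≤ φ s := fun s => by
    rw [← bernoulliExp_const (α := α) p 0]
    exact bernoulliExp_mono h0 h1 fun S => (Real.exp_pos _).le
  have hder : ∀ s, HasDerivAt (fun s => φ s * Real.exp (μ * (s - K * s ^ 2)))
      (-bernoulliExp p (fun S => X S * Real.exp (-(s * X S))) * Real.exp (μ * (s - K * s ^ 2)) +
        φ s * (Real.exp (μ * (s - K * s ^ 2)) * (μ * (1 - K * (2 * s))))) s := by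
    intro s
    refine (hasDerivAt_bernoulliExp_exp p s X).mul (HasDerivAt.exp ?_)
    have := (((hasDerivAt_id s).sub (((hasDerivAt_id s).pow 2).const_mul K)).const_mul μ)
    refine this.congr_deriv ?_
    norm_num [id]
  have hle : ∀ s, 0 ≤ s → μ * (φ s * (1 - s * K)) ≤
      bernoulliExp p (fun S => X S * Real.exp (-(s * X S))) := by
    intro s hs
    have e : (fun S => X S * Real.exp (-(s * X S))) =
        fun S => ∑ i ∈ I, if T i ⊆ S then Real.exp (-(s * X S)) else 0 := by
      funext S
      exact containedCount_mul I T S _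
    rw [e, bernoulliExp_sum, hμ, mul_assoc, ← nsmul_eq_mul]
    exact Finset.card_nsmul_le_sum _ _ _ fun i hi => h.bernoulliExp_mul_exp_ge h0 h1 hs hi
  -- Integrates `φ' ≤ -μ (1 - K s) φ`. The exact integrating factor has `K s^2 / 2`; the cruder `K
  -- s^2` only loses a nonnegative term.
  have hanti : AntitoneOn (fun s => φ s * Real.exp (μ * (s - K * s ^ 2))) (Set.Ici 0) := by
    refine antitoneOn_of_deriv_nonpos (convex_Ici 0)
      (fun s _ => (hder s).continuousAt.continuousWithinAt)
      (fun s _ => (hder s).differentiableAt.differentiableWithinAt) fun s hs => ?_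
    rw [interior_Ici, Set.mem_Ioi] at hs
    rw [(hder s).deriv]
    have hE := (Real.exp_pos (μ * (s - K * s ^ 2))).le
    have h2 : φ s * (μ * (1 - K * (2 * s))) ≤
        bernoulliExp p (fun S => X S * Real.exp (-(s * X S))) := by
      refine le_trans ?_ (hle s hs.le)
      have : 0 ≤ μ * φ s * (K * s) :=
        mul_nonneg (mul_nonneg hμ0 (hφ0 s)) (mul_nonneg hK0 hs.le)
      nlinarith
    nlinarith [mul_le_mul_of_nonneg_right h2 hE]
  have := hanti Set.self_mem_Ici hs hs
  simp only [φ, zero_mul, neg_zero, Real.exp_zero, bernoulliExp_const] at this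
  norm_num at this
  rw [Real.exp_neg, ← one_div, le_div_iff₀ (Real.exp_pos _)]
  exact this

/-- Lower tail estimate from the Laplace transform. -/
lemma IsLinearTripleSystem.lower_tail (h : IsLinearTripleSystem I T D) {p : ℝ}
    (h0 : 0 ≤ p) (h1 : p ≤ 1) {s : ℝ} (hs : 0 ≤ s) (y : ℝ) :
    bernoulliExp p (fun S => if containedCount I T S ≤ y then 1 else 0) ≤
      Real.exp (s * y - I.card * p ^ 3 * (s - (3 * (D * p ^ 2) + 9) * s ^ 2)) := by
  rw [sub_eq_add_neg, Real.exp_add]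
  refine le_trans ?_ (mul_le_mul_of_nonneg_left (h.laplace_le h0 h1 hs) (Real.exp_pos _).le)
  rw [← bernoulliExp_const_mul]
  refine bernoulliExp_mono h0 h1 fun S => ?_
  rw [← Real.exp_add]
  split_ifs with hS
  · exact Real.one_le_exp (by nlinarith [mul_le_mul_of_nonneg_left hS hs])
  · exact (Real.exp_pos _).le

end LinearHypergraph

/-! ### Translation from random graphs to random edge sets. -/

section RandomGraph

variable {V : Type*} [Fintype V] [DecidableEq V]

/-- The graph with edge set `S`. -/
def graphOfEdges (S : Finset {e : Sym2 V // ¬ e.IsDiag}) : SimpleGraph V :=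
  SimpleGraph.fromEdgeSet (Subtype.val '' (S : Set {e : Sym2 V // ¬ e.IsDiag}))

/-- The edges of the complete graph on the vertex set `t`. -/
def cliqueEdges (t : Finset V) : Finset {e : Sym2 V // ¬ e.IsDiag} :=
  Finset.univ.filter fun e => ∀ v ∈ e.1, v ∈ t

omit [Fintype V] [DecidableEq V] in
lemma edgeSet_graphOfEdges (S : Finset {e : Sym2 V // ¬ e.IsDiag}) :
    (graphOfEdges S).edgeSet = Subtype.val '' (S : Set {e : Sym2 V // ¬ e.IsDiag}) := by
  rw [graphOfEdges, SimpleGraph.edgeSet_fromEdgeSet]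
  ext e
  simp only [Set.mem_sdiff, Set.mem_image]
  exact ⟨fun h => h.1, fun h => ⟨h, by obtain ⟨f, -, rfl⟩ := h; exact f.2⟩⟩

/-- Turns integrals over graphs into sums over edge sets. -/
lemma graphOfEdges_bijective :
    Function.Bijective (graphOfEdges : Finset {e : Sym2 V // ¬ e.IsDiag} → SimpleGraph V) := by
  classical
  constructor
  · intro S S' h
    have := congrArg SimpleGraph.edgeSet h
    rw [edgeSet_graphOfEdges, edgeSet_graphOfEdges] at this
    exact Finset.coe_injective (Subtype.val_injective.image_injective this)
  · intro G
    refine ⟨Finset.univ.filter fun e => e.1 ∈ G.edgeSet, ?_⟩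
    rw [← SimpleGraph.edgeSet_inj, edgeSet_graphOfEdges]
    ext e
    simp only [Finset.coe_filter, Finset.mem_univ, true_and, Set.mem_image]
    exact ⟨by rintro ⟨f, hf, rfl⟩; exact hf, fun h => ⟨⟨e, G.not_isDiag_of_mem_edgeSet h⟩, h, rfl⟩⟩

lemma binomialRandom_real_graphOfEdges (p : unitInterval)
    (S : Finset {e : Sym2 V // ¬ e.IsDiag}) :
    (SimpleGraph.binomialRandom V p).real {graphOfEdges S} = bernoulliWeight (p : ℝ) S := by
  have hn : (graphOfEdges S).edgeSet.ncard = S.card := by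
    rw [edgeSet_graphOfEdges, Set.ncard_image_of_injective _ Subtype.val_injective,
      Set.ncard_coe_finset]
  have hc : (Nat.card V).choose 2 = Fintype.card {e : Sym2 V // ¬ e.IsDiag} := by
    rw [Nat.card_eq_fintype_card, Sym2.card_subtype_not_diag]
  rw [measureReal_def, SimpleGraph.binomialRandom_singleton, hn, hc, bernoulliWeight]
  simp

omit [DecidableEq V] in
lemma measurableSingletonClass_simpleGraph : MeasurableSingletonClass (SimpleGraph V) where
  measurableSet_singleton G := by
    have : {G} = SimpleGraph.edgeSet ⁻¹' {G.edgeSet} := by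
      ext H
      simp
    rw [this]
    exact SimpleGraph.measurable_edgeSet (Set.toFinite _).measurableSet

lemma integral_binomialRandom (p : unitInterval) (F : SimpleGraph V → ℝ) :
    ∫ G, F G ∂(SimpleGraph.binomialRandom V p) =
      bernoulliExp (p : ℝ) fun S : Finset {e : Sym2 V // ¬ e.IsDiag} => F (graphOfEdges S) := by
  classical
  have := measurableSingletonClass_simpleGraph (V := V)
  rw [integral_fintype Integrable.of_finite, bernoulliExp]
  refine (Function.Bijective.sum_comp graphOfEdges_bijective _).symm.trans ?_
  simp only [binomialRandom_real_graphOfEdges, smul_eq_mul]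

lemma binomialRandom_real (p : unitInterval) (A : Set (SimpleGraph V)) [DecidablePred (· ∈ A)] :
    (SimpleGraph.binomialRandom V p).real A =
      bernoulliExp (p : ℝ) fun S : Finset {e : Sym2 V // ¬ e.IsDiag} =>
        if graphOfEdges S ∈ A then 1 else 0 := by
  have := measurableSingletonClass_simpleGraph (V := V)
  rw [← integral_indicator_one A.toFinite.measurableSet, integral_binomialRandom]
  simp only [Set.indicator_apply, Pi.one_apply]

lemma isNClique_graphOfEdges_iff (n : ℕ) (S : Finset {e : Sym2 V // ¬ e.IsDiag}) (t : Finset V) :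
    (graphOfEdges S).IsNClique n t ↔
      t ∈ Finset.univ.powersetCard n ∧ cliqueEdges t ⊆ S := by
  rw [SimpleGraph.isNClique_iff, Finset.mem_powersetCard_univ, and_comm]
  refine and_congr_right fun _ => ?_
  have adj : ∀ a b, (h : ¬ (s(a, b)).IsDiag) → ((graphOfEdges S).Adj a b ↔ ⟨s(a, b), h⟩ ∈ S) := by
    intro a b h
    rw [← SimpleGraph.mem_edgeSet, edgeSet_graphOfEdges]
    simp [h]
  constructor
  · rintro h ⟨e, he⟩ het
    induction e using Sym2.ind with
    | _ a b =>
      simp only [cliqueEdges, Finset.mem_filter, Finset.mem_univ, true_and, Sym2.mem_iff,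
        forall_eq_or_imp, forall_eq] at het
      exact (adj a b he).1 (h het.1 het.2 (by simpa using he))
  · intro h a ha b hb hab
    refine (adj a b (by simpa using hab)).2 (h ?_)
    simp only [cliqueEdges, Finset.mem_filter, Finset.mem_univ, true_and, Sym2.mem_iff,
      forall_eq_or_imp, forall_eq]
    exact ⟨ha, hb⟩

lemma ncard_cliqueSet_graphOfEdges (S : Finset {e : Sym2 V // ¬ e.IsDiag}) (n : ℕ) :
    (((graphOfEdges S).cliqueSet n).ncard : ℝ) =
      containedCount (Finset.univ.powersetCard n) cliqueEdges S := by
  have : (graphOfEdges S).cliqueSet n =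
      ((Finset.univ.powersetCard n).filter fun t => cliqueEdges t ⊆ S : Finset (Finset V)) := by
    ext t
    rw [SimpleGraph.mem_cliqueSet_iff, isNClique_graphOfEdges_iff, Finset.mem_coe,
      Finset.mem_filter]
  rw [this, Set.ncard_coe_finset, containedCount, Finset.sum_boole]

lemma mk_mem_cliqueEdges {t : Finset V} {a b : V} (h : ¬ (s(a, b)).IsDiag) :
    ⟨s(a, b), h⟩ ∈ cliqueEdges t ↔ a ∈ t ∧ b ∈ t := by
  simp [cliqueEdges]

/-- The edge sets of triangles form a linear triple system. -/
lemma isLinearTripleSystem_cliqueEdges :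
    IsLinearTripleSystem (Finset.univ.powersetCard 3) (cliqueEdges : Finset V → _)
      (Fintype.card V) where
  card_eq t ht := by
    rw [Finset.mem_powersetCard_univ] at ht
    obtain ⟨a, b, c, hab, hac, hbc, rfl⟩ := Finset.card_eq_three.1 ht
    have h1 : ¬ (s(a, b)).IsDiag := by simpa using hab
    have h2 : ¬ (s(a, c)).IsDiag := by simpa using hac
    have h3 : ¬ (s(b, c)).IsDiag := by simpa using hbc
    rw [Finset.card_eq_three]
    refine ⟨⟨s(a, b), h1⟩, ⟨s(a, c), h2⟩, ⟨s(b, c), h3⟩, ?_, ?_, ?_, ?_⟩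
    · simp [hbc, hac]
    · simp [hab, hac]
    · simp [hab, hac]
    · ext ⟨e, he⟩
      induction e using Sym2.ind with
      | _ x y =>
        rw [mk_mem_cliqueEdges]
        have hxy : x ≠ y := by simpa using he
        simp only [Finset.mem_insert, Finset.mem_singleton, Subtype.mk.injEq, Sym2.eq_iff]
        constructor
        · rintro ⟨rfl | rfl | rfl, rfl | rfl | rfl⟩ <;> simp at hxy ⊢
        · rintro ((⟨rfl, rfl⟩ | ⟨rfl, rfl⟩) | (⟨rfl, rfl⟩ | ⟨rfl, rfl⟩) |
            (⟨rfl, rfl⟩ | ⟨rfl, rfl⟩)) <;> simp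
  degree_le := by
    rintro ⟨e, he⟩
    induction e using Sym2.ind with
    | _ a b =>
      have hab : a ≠ b := by simpa using he
      refine (Finset.card_le_card (t := Finset.univ.image fun c => {a, b, c}) ?_).trans
        Finset.card_image_le
      intro t ht
      rw [Finset.mem_filter, Finset.mem_powersetCard_univ, mk_mem_cliqueEdges] at ht
      obtain ⟨h3, ha, hb⟩ := ht
      have h1 : ((t.erase a).erase b).card = 1 := by
        rw [Finset.card_erase_of_mem (Finset.mem_erase.2 ⟨hab.symm, hb⟩),
          Finset.card_erase_of_mem ha, h3]
      obtain ⟨c, hc⟩ := Finset.card_eq_one.1 h1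
      refine Finset.mem_image.2 ⟨c, Finset.mem_univ _, ?_⟩
      rw [← hc, Finset.insert_erase (Finset.mem_erase.2 ⟨hab.symm, hb⟩), Finset.insert_erase ha]
  codegree_le := by
    rintro ⟨e, he⟩ ⟨f, hf⟩ hne
    induction e using Sym2.ind with
    | _ a b =>
    induction f using Sym2.ind with
    | _ c d =>
      have hab : a ≠ b := by simpa using he
      have hcd : c ≠ d := by simpa using hf
      have hne' : ¬ (a = c ∧ b = d ∨ a = d ∧ b = c) := by
        simpa only [ne_eq, Subtype.mk.injEq, Sym2.eq_iff] using hne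
      -- Two distinct edges span at least three vertices, so they determine any triangle containing
      -- both.
      have key : ∃ x, x ≠ a ∧ x ≠ b ∧ (x = c ∨ x = d) := by
        by_cases hc : c ≠ a ∧ c ≠ b
        · exact ⟨c, hc.1, hc.2, Or.inl rfl⟩
        · refine ⟨d, ?_, ?_, Or.inr rfl⟩ <;> grind
      obtain ⟨x, hxa, hxb, hx⟩ := key
      have uniq : ∀ t : Finset V, t.card = 3 → a ∈ t → b ∈ t → c ∈ t → d ∈ t → t = {a, b, x} := by
        intro t h3 ha hb hc hd
        refine (Finset.eq_of_subset_of_card_le ?_ ?_).symm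
        · have : x ∈ t := by rcases hx with rfl | rfl <;> assumption
          simp [Finset.insert_subset_iff, ha, hb, this]
        · rw [h3, Finset.card_eq_three.2 ⟨a, b, x, hab, hxa.symm, hxb.symm, rfl⟩]
      refine Finset.card_le_one.2 fun t ht t' ht' => ?_
      simp only [Finset.mem_filter, Finset.mem_powersetCard_univ, mk_mem_cliqueEdges] at ht ht'
      rw [uniq t ht.1 ht.2.1.1 ht.2.1.2 ht.2.2.1 ht.2.2.2,
        uniq t' ht'.1 ht'.2.1.1 ht'.2.1.2 ht'.2.2.1 ht'.2.2.2]

end RandomGraph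

/-! ### Choice of parameters and the concentration bound. -/

section Concentration

/-- Both tails of the number of members of a linear triple system in a `p`-random set. -/
lemma IsLinearTripleSystem.deviation_le {α ι : Type*} [DecidableEq α] [Fintype α] {I : Finset ι}
    {T : ι → Finset α} {D : ℕ} (h : IsLinearTripleSystem I T D) {p x : ℝ} (h0 : 0 ≤ p)
    (h1 : p ≤ 1) (hD : D * p ^ 2 ≤ 1) (hx : 1008 ≤ x) (hμ : x ^ 6 / 12 ≤ I.card * p ^ 3) :
    bernoulliExp p (fun S => if x⁻¹ * (I.card * p ^ 3) ≤
        |containedCount I T S - I.card * p ^ 3| then 1 else 0) ≤ 2 * Real.exp (-(x / 4)) := by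
  have hx0 : 0 < x := by linarith
  have upper := fun y (hy : 0 < y) => h.upper_tail h0 h1 ⌈x ^ 2⌉₊ hy
  -- This `s` minimises `-s μ / x + 12 μ s^2`, where 12 bounds `3 D p^2 + 9`.
  have lower := fun y => h.lower_tail h0 h1 (s := 1 / (24 * x)) (by positivity) y
  set μ : ℝ := I.card * p ^ 3 with hμd
  have hμ0 : 0 < μ := lt_of_lt_of_le (by positivity) hμ
  have hU : bernoulliExp p (fun S => if (1 + x⁻¹) * μ ≤ containedCount I T S then 1 else 0) ≤
      Real.exp (-(x / 4)) := by
    refine (upper _ (by positivity)).trans ?_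
    set k := ⌈x ^ 2⌉₊
    have hk1 : x ^ 2 ≤ k := Nat.le_ceil _
    have hk2 : (k : ℝ) ≤ 2 * x ^ 2 := by
      have := (Nat.ceil_lt_add_one (sq_nonneg x)).le
      change (k : ℝ) ≤ _ at this
      nlinarith
    have hB : μ + ((3 * k : ℕ) * (D * p ^ 2) + ((3 * k : ℕ) : ℝ) ^ 2) ≤
        (1 + x⁻¹ / 2) * μ := by
      push_cast
      have e1 : 3 * (k : ℝ) * (D * p ^ 2) ≤ 6 * x ^ 2 := by
        calc 3 * (k : ℝ) * (D * p ^ 2) ≤ 3 * (k : ℝ) * 1 :=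
              mul_le_mul_of_nonneg_left hD (by positivity)
          _ ≤ 6 * x ^ 2 := by linarith
      have e2 : (3 * (k : ℝ)) ^ 2 ≤ (6 * x ^ 2) ^ 2 := by
        exact pow_le_pow_left₀ (by positivity) (by linarith) 2
      have e3 : x ^ 5 / 24 ≤ x⁻¹ / 2 * μ := by
        calc x ^ 5 / 24 = x⁻¹ / 2 * (x ^ 6 / 12) := by field_simp; ring
          _ ≤ x⁻¹ / 2 * μ := by gcongr
      have e4 : 6 * x ^ 2 ≤ 6 * x ^ 4 := by
        have : x ^ 2 ≤ x ^ 4 := pow_le_pow_right₀ (by linarith) (by norm_num)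
        linarith
      -- The excess is at most `6 x^2 + 36 x^4 ≤ 42 x^4`, and `1008 = 24 * 42` makes this at most
      -- `x^5 / 24`.
      have e5 : 1008 * x ^ 4 ≤ x ^ 5 := by
        rw [pow_succ' x 4]
        gcongr
      nlinarith
    have hq : (1 + x⁻¹ / 2) * μ / ((1 + x⁻¹) * μ) ≤ Real.exp (-(x⁻¹ / 4)) := by
      rw [mul_div_mul_right _ _ hμ0.ne']
      refine le_trans ?_ (Real.one_sub_le_exp_neg _)
      have hi : 0 < x⁻¹ := by positivity
      have hi1 : x⁻¹ ≤ 1 := inv_le_one_of_one_le₀ (by linarith)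
      rw [div_le_iff₀ (by positivity)]
      nlinarith
    calc _ ≤ ((1 + x⁻¹ / 2) * μ / ((1 + x⁻¹) * μ)) ^ k := by gcongr
      _ ≤ Real.exp (-(x⁻¹ / 4)) ^ k := by gcongr
      _ = Real.exp (-(x⁻¹ / 4 * k)) := by rw [← Real.exp_nat_mul]; congr 1; ring
      _ ≤ Real.exp (-(x / 4)) := by
        rw [Real.exp_le_exp, neg_le_neg_iff]
        calc x / 4 = x⁻¹ / 4 * x ^ 2 := by field_simp
          _ ≤ x⁻¹ / 4 * k := by gcongr
  have hL : bernoulliExp p (fun S => if containedCount I T S ≤ (1 - x⁻¹) * μ then 1 else 0) ≤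
      Real.exp (-(x / 4)) := by
    refine (lower _).trans (Real.exp_le_exp.2 ?_)
    have hK : μ * ((3 * (D * p ^ 2) + 9) * (1 / (24 * x)) ^ 2) ≤
        μ * (12 * (1 / (24 * x)) ^ 2) := by
      gcongr
      linarith
    have e1 : 1 / (24 * x) * ((1 - x⁻¹) * μ) - μ * (1 / (24 * x)) +
        μ * (12 * (1 / (24 * x)) ^ 2) = -(μ / (48 * x ^ 2)) := by
      field_simp
      ring
    have e2 : x / 4 ≤ μ / (48 * x ^ 2) := by
      rw [le_div_iff₀ (by positivity)]
      have : 144 * x ^ 3 ≤ x ^ 6 := by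
        rw [show x ^ 6 = x ^ 3 * x ^ 3 by ring]
        gcongr
        calc (144 : ℝ) ≤ 1008 ^ 3 := by norm_num
          _ ≤ x ^ 3 := by gcongr
      nlinarith
    linarith
  rw [two_mul]
  refine le_trans ?_ (add_le_add hU hL)
  simp only [bernoulliExp, ← Finset.sum_add_distrib, ← mul_add]
  refine bernoulliExp_mono h0 h1 fun S => ?_
  by_cases hS : x⁻¹ * μ ≤ |containedCount I T S - μ|
  · rw [if_pos hS]
    rcases le_abs.1 hS with h' | h'
    · rw [if_pos (by linarith : (1 + x⁻¹) * μ ≤ containedCount I T S)]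
      split_ifs <;> norm_num
    · rw [if_pos (by linarith : containedCount I T S ≤ (1 - x⁻¹) * μ)]
      split_ifs <;> norm_num
  · rw [if_neg hS]
    split_ifs <;> norm_num

lemma expectedTriangles_eq (N : ℕ) :
    expectedTriangles N = ((Finset.univ : Finset (Fin N)).powersetCard 3).card *
      (edgeProb N : ℝ) ^ 3 := by
  rw [expectedTriangles, randomGraph, integral_binomialRandom]
  simp only [triangleCount, ncard_cliqueSet_graphOfEdges]
  exact isLinearTripleSystem_cliqueEdges.bernoulliExp_containedCount _

/-- Equivalent to `N^2 - 6 N + 4 ≥ 0` for positive `N`, which holds from 6 on. -/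
lemma cube_div_twelve_le_choose {N : ℕ} (hN : 6 ≤ N) : (N : ℝ) ^ 3 / 12 ≤ (N.choose 3 : ℝ) := by
  obtain ⟨n, rfl⟩ := Nat.exists_eq_add_of_le hN
  have h : ((6 + n).choose 3 : ℝ) = (6 + n) * (5 + n) * (4 + n) / 6 := by
    rw [Nat.cast_choose_eq_ascPochhammer_div]
    rw [show 6 + n - (3 - 1) = 4 + n by omega]
    simp [ascPochhammer_succ_eval, Nat.factorial]
    ring
  rw [h]
  push_cast
  have : (0 : ℝ) ≤ n := n.cast_nonneg
  nlinarith [pow_nonneg this 2, pow_nonneg this 3]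

theorem mainTheorem5 :
    ∃ t : ℕ → ℝ, t =o[atTop] expectedTriangles ∧
      ∀ᶠ N : ℕ in atTop,
        (randomGraph N).real
            {G : SimpleGraph (Fin N) | t N ≤ |triangleCount G - expectedTriangles N|} <
          Real.exp (-(N : ℝ) ^ (1 / 13 : ℝ)) := by
  have hx : Tendsto (fun N : ℕ => (N : ℝ) ^ (1 / 8 : ℝ)) atTop atTop :=
    (tendsto_rpow_atTop (by norm_num)).comp tendsto_natCast_atTop_atTop
  refine ⟨fun N => ((N : ℝ) ^ (1 / 8 : ℝ))⁻¹ * expectedTriangles N, ?_, ?_⟩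
  · have : (fun N : ℕ => ((N : ℝ) ^ (1 / 8 : ℝ))⁻¹) =o[atTop] fun _ => (1 : ℝ) :=
      (isLittleO_one_iff ℝ).2 hx.inv_tendsto_atTop
    simpa using this.mul_isBigO (isBigO_refl expectedTriangles atTop)
  · have hsmall : ∀ᶠ N : ℕ in atTop, (N : ℝ) ^ (1 / 13 : ℝ) ≤ 1 / 8 * (N : ℝ) ^ (1 / 8 : ℝ) := by
      have h := (tendsto_rpow_atTop (by norm_num : (0 : ℝ) < 5 / 104)).comp
        (tendsto_natCast_atTop_atTop (R := ℝ))
      filter_upwards [h.eventually_ge_atTop 8, eventually_gt_atTop 0] with N h8 hN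
      -- `5/104 = 1/8 - 1/13`.
      have e : (N : ℝ) ^ (1 / 8 : ℝ) = (N : ℝ) ^ (1 / 13 : ℝ) * (N : ℝ) ^ (5 / 104 : ℝ) := by
        rw [← Real.rpow_add (by exact_mod_cast hN)]
        norm_num
      rw [e]
      have := mul_le_mul_of_nonneg_left h8 (Real.rpow_nonneg N.cast_nonneg (1 / 13 : ℝ))
      simp only [Function.comp_apply] at this
      linarith
    filter_upwards [hsmall, hx.eventually_ge_atTop 1008, eventually_ge_atTop 6] with N h13 hxN hN
    classical
    set x : ℝ := (N : ℝ) ^ (1 / 8 : ℝ) with hxd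
    have hx0 : 0 < x := by linarith
    have hN0 : (0 : ℝ) ≤ N := N.cast_nonneg
    have hNx : (N : ℝ) = x ^ 8 := by
      rw [hxd, ← Real.rpow_natCast, ← Real.rpow_mul hN0]
      norm_num
    have hp : (edgeProb N : ℝ) = (x ^ 6)⁻¹ := by
      change (N : ℝ) ^ (-(3 / 4) : ℝ) = _
      rw [Real.rpow_neg hN0, hxd, ← Real.rpow_natCast, ← Real.rpow_mul hN0]
      norm_num
    have hD : (Fintype.card (Fin N) : ℝ) * (edgeProb N : ℝ) ^ 2 ≤ 1 := by
      rw [Fintype.card_fin, hNx, hp, inv_pow, ← pow_mul, ← div_eq_mul_inv]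
      exact div_le_one_of_le₀ (pow_le_pow_right₀ (by linarith) (by norm_num)) (by positivity)
    have hμ : x ^ 6 / 12 ≤ ((Finset.univ : Finset (Fin N)).powersetCard 3).card *
        (edgeProb N : ℝ) ^ 3 := by
      rw [Finset.card_powersetCard, Finset.card_univ, Fintype.card_fin, hp]
      have := cube_div_twelve_le_choose hN
      rw [hNx] at this
      calc x ^ 6 / 12 = (x ^ 8) ^ 3 / 12 * (x ^ 6)⁻¹ ^ 3 := by field_simp
        _ ≤ _ := by gcongr
    have key := isLinearTripleSystem_cliqueEdges.deviation_le (edgeProb N).2.1 (edgeProb N).2.2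
      hD hxN hμ
    rw [randomGraph, binomialRandom_real]
    simp only [Set.mem_ofPred_eq, triangleCount, ncard_cliqueSet_graphOfEdges,
      expectedTriangles_eq]
    refine lt_of_le_of_lt (le_of_eq_of_le ?_ key) ?_
    · congr!
    -- Strictness comes from `2 < e`; then `1 - x/4 ≤ -x/8 ≤ -N^(1/13)`.
    · calc 2 * Real.exp (-(x / 4)) < Real.exp 1 * Real.exp (-(x / 4)) := by
            gcongr
            exact lt_trans (by norm_num) Real.exp_one_gt_d9
        _ = Real.exp (1 - x / 4) := by rw [← Real.exp_add]; rfl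
        _ ≤ _ := Real.exp_le_exp.2 (by linarith)

end Concentration
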